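/- Classical modal formulae are built from countably many propositional variables by $\bot,\top,\wedge,\neg,\square$. A \emph{rule} $\Gamma/\Delta$ is a pair of finite sets of formulae, and $\mathrm{Sfor}(\Gamma/\Delta)$ is the set of all subformulae of members of $\Gamma\cup\Delta$. A \emph{modal algebra} is a Boolean algebra with an operation $\square$ such that $\square 1=1$ and $\square(a\wedge b)=\square a\wedge\square b$. It is a \emph{$\mathsf{K4}$-algebra} if $\square a\le\square\square a$ for all $a$, and a \emph{Magari algebra} if moreover $\square(\square a\to a)\le\square a$ for all $a$. Write $\square^+a:=\square a\wedge a$. A \emph{valuation} on a modal algebra $\mathfrak M$ is a map $V$ from formulae to $\mathfrak M$ that commutes with all connectives; $(\mathfrak M,V)$ is then called a \emph{model}. The model $(\mathfrak M,V)$ \emph{refutes} $\Gamma/\Delta$ if $V(\gamma)=1$ for all $\gamma\in\Gamma$ and $V(\delta)\ne 1$ for all $\delta\in\Delta$; and $\mathfrak M$ refutes $\Gamma/\Delta$ if some model $(\mathfrak M,V)$ does. Let $\mathfrak M$ be a $\mathsf{K4}$-algebra, $V$ a valuation on $\mathfrak M$, and $\Theta$ a finite set of formulae closed under subformulae. A finite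 model $(\mathfrak N,V')$ with $\mathfrak N$ a $\mathsf{K4}$-algebra is a \emph{pre-filtration of $(\mathfrak M,V)$ through $\Theta$} if 1. the $\square$-free reduct of $\mathfrak N$ is the Boolean subalgebra of $\mathfrak M$ generated by some finite superset of $V[\Theta]$; 2. $V'(p)=V(p)$ for every propositional variable $p\in\Theta$; 3. $\square^+_{\mathfrak N}a\le\square^+_{\mathfrak M}a$ for all $a\in\mathfrak N$, and $\square_{\mathfrak N}V(\varphi)=\square_{\mathfrak M}V(\varphi)$ whenever $\square\varphi\in\Theta$. \textbf{Theorem.} Let $\mathfrak M$ be a Magari algebra. If $\mathfrak M$ refutes a rule $\Gamma/\Delta$, then there is a valuation $V$ on $\mathfrak M$ such that the model $(\mathfrak M,V)$ refutes $\Gamma/\Delta$ and has a pre-filtration $(\mathfrak N,V')$ through $\mathrm{Sfor}(\Gamma/\Delta)$ in which $\mathfrak N$ is a (finite) Magari algebra. -/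

import Mathlib

/-- Classical modal formulae over the countably infinite set `ℕ` of propositional variables, with
primitive connectives `⊥`, `⊤`, `∧`, `¬`, `□`. -/
inductive ModalFormula : Type
  | var (p : ℕ) : ModalFormula
  | bot : ModalFormula
  | top : ModalFormula
  | and (φ ψ : ModalFormula) : ModalFormula
  | neg (φ : ModalFormula) : ModalFormula
  | box (φ : ModalFormula) : ModalFormula

/-- The set of subformulae of a formula (the formula itself included). -/
def ModalFormula.subformulas : ModalFormula → Set ModalFormula
  | .var p => {.var p}
  | .bot => {.bot}
  | .top => {.top}
  | .and φ ψ => insert (.and φ ψ) (φ.subformulas ∪ ψ.subformulas)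
  | .neg φ => insert (.neg φ) φ.subformulas
  | .box φ => insert (.box φ) φ.subformulas

/-- `Θ` contains every subformula of each of its members. -/
def SubformulaClosed (Θ : Set ModalFormula) : Prop :=
  ∀ φ ∈ Θ, φ.subformulas ⊆ Θ

/-- A rule `Γ/Δ`: a pair of finite sets of formulae. -/
structure ModalRule : Type where
  premises : Finset ModalFormula
  conclusions : Finset ModalFormula

/-- All subformulae of the premises and the conclusions of a rule. -/
def ModalRule.sfor (r : ModalRule) : Set ModalFormula :=
  {ψ | ∃ φ, (φ ∈ r.premises ∨ φ ∈ r.conclusions) ∧ ψ ∈ φ.subformulas}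

/-- `(M, box)` is a modal algebra. -/
structure IsModalAlgebra {M : Type*} [BooleanAlgebra M] (box : M → M) : Prop where
  box_top : box ⊤ = ⊤
  box_inf : ∀ a b : M, box (a ⊓ b) = box a ⊓ box b

/-- `(M, box)` is a `K4`-algebra. -/
structure IsK4Algebra {M : Type*} [BooleanAlgebra M] (box : M → M) : Prop
    extends IsModalAlgebra box where
  box_le_box_box : ∀ a : M, box a ≤ box (box a)

/-- `(M, box)` is a Magari algebra; `a ⇨ b` is the Boolean implication `aᶜ ⊔ b`. -/
structure IsMagariAlgebra {M : Type*} [BooleanAlgebra M] (box : M → M) : Prop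
    extends IsK4Algebra box where
  loeb : ∀ a : M, box (box a ⇨ a) ≤ box a

/-- The derived operator `□⁺ a = □ a ∧ a`. -/
def boxPlus {M : Type*} [BooleanAlgebra M] (box : M → M) (a : M) : M := box a ⊓ a

/-- `V` is a valuation on `(M, box)`: it commutes with all primitive connectives. -/
structure IsValuation {M : Type*} [BooleanAlgebra M] (box : M → M) (V : ModalFormula → M) :
    Prop where
  map_bot : V .bot = ⊥
  map_top : V .top = ⊤
  map_and : ∀ φ ψ, V (.and φ ψ) = V φ ⊓ V ψ
  map_neg : ∀ φ, V (.neg φ) = (V φ)ᶜ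
  map_box : ∀ φ, V (.box φ) = box (V φ)

/-- The valuation `V` satisfies the rule `r`. -/
def ModalRule.SatisfiedBy (r : ModalRule) {M : Type*} [BooleanAlgebra M] (V : ModalFormula → M) :
    Prop :=
  (∀ γ ∈ r.premises, V γ = ⊤) → ∃ δ ∈ r.conclusions, V δ = ⊤

/-- The rule `r` is valid on `(M, box)`. -/
def ModalRule.ValidOn (r : ModalRule) {M : Type*} [BooleanAlgebra M] (box : M → M) : Prop :=
  ∀ V : ModalFormula → M, IsValuation box V → r.SatisfiedBy V

/-- `h : (A, boxA) → (B, boxB)` is a pre-stable embedding. A bounded lattice homomorphism between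
Boolean algebras automatically preserves complements. -/
structure IsPreStableEmbedding {A B : Type*} [BooleanAlgebra A] [BooleanAlgebra B]
    (boxA : A → A) (boxB : B → B) (h : BoundedLatticeHom A B) : Prop where
  injective : Function.Injective h
  boxPlus_le : ∀ a : A, h (boxPlus boxA a) ≤ boxPlus boxB (h a)

/-- The bounded domain condition of a map `h : A → B` for the domain `D`, with respect to the
unary operators `opA` and `opB`. -/
def BoundedDomainCondition {A B : Type*} (opA : A → A) (opB : B → B) (h : A → B) (D : Set A) :
    Prop :=
  ∀ a ∈ D, h (opA a) = opB (h a)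

/-- The model `((N, boxN), V')` is a pre-filtration of the model `((M, box), V)` through `Θ`. The
`□`-free reduct of the first algebra is the Boolean subalgebra `N` of `M`. -/
structure IsPreFiltration {M : Type*} [BooleanAlgebra M] (box : M → M) (V : ModalFormula → M)
    (Θ : Set ModalFormula) (N : BooleanSubalgebra M) (boxN : N → N) (V' : ModalFormula → N) :
    Prop where
  isK4Algebra : IsK4Algebra box
  isValuation : IsValuation box V
  finite_formulas : Θ.Finite
  subformulaClosed : SubformulaClosed Θ
  finite_algebra : Finite N
  isK4Algebra' : IsK4Algebra boxN
  isValuation' : IsValuation boxN V'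
  generated : ∃ S : Set M, S.Finite ∧ V '' Θ ⊆ S ∧ N = BooleanSubalgebra.closure S
  agree_var : ∀ p : ℕ, .var p ∈ Θ → (V' (.var p) : M) = V (.var p)
  preStable : IsPreStableEmbedding boxN box N.subtype
  boundedDomain : BoundedDomainCondition boxN box N.subtype
    {a : N | ∃ φ, .box φ ∈ Θ ∧ (a : M) = V φ}

/-! Work in the Stone space of `M`, colouring each point by its type: the formulae of Θ = Sfor(Γ/Δ)
true there under a refuting valuation `W`. The profile of a point records the colours it sees, and
its own colour only if that colour is not already seen. There are finitely many profiles, each with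
a clopen fibre, so the elements of `M` that are unions of fibres form a finite Boolean subalgebra
`N`. The relation `Below` depends only on profiles and is a strict order on them, which makes `N` a
Magari algebra. Related points are either in `Below` or share a profile, which gives the condition
on □⁺.

Points of one profile may differ in type, so `W` need not take its values in `N` on Θ. The valuation
is therefore changed: each point reads the variables at a chosen representative of its profile.
Löb's axiom makes this harmless. Any colour seen from `x` occurs at a point `u` seen from `x` that
does not see that colour again (`Rel.exists_maximal`); the profile of `u` determines its colour, so
recolouring leaves `u` alone. Hence recolouring preserves the colours seen, and `Below` reaches the
same colours as `Rel` (`exists_rel_iff`, `exists_below_iff`). The first fact gives `truth_iff`, the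
second the bounded domain condition. -/

/-! ### Stone duality for Boolean algebras. -/

/-- A point of the Stone space of a Boolean algebra: an ultrafilter of its elements. -/
structure StonePoint (M : Type*) [BooleanAlgebra M] where
  mem : M → Prop
  mem_top : mem ⊤
  mem_inf : ∀ a b, mem (a ⊓ b) ↔ mem a ∧ mem b
  mem_compl : ∀ a, mem aᶜ ↔ ¬ mem a

namespace StonePoint

variable {M : Type*} [BooleanAlgebra M]

theorem not_mem_bot (x : StonePoint M) : ¬ x.mem ⊥ := by
  rw [← compl_top, x.mem_compl]
  exact not_not.mpr x.mem_top

theorem mem_sup (x : StonePoint M) (a b : M) : x.mem (a ⊔ b) ↔ x.mem a ∨ x.mem b := by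
  rw [← compl_compl (a ⊔ b), compl_sup, x.mem_compl, x.mem_inf, x.mem_compl, x.mem_compl]
  tauto

theorem mem_himp (x : StonePoint M) (a b : M) : x.mem (a ⇨ b) ↔ (x.mem a → x.mem b) := by
  rw [himp_eq, x.mem_sup, x.mem_compl]
  tauto

theorem mem_of_le (x : StonePoint M) {a b : M} (h : a ≤ b) (ha : x.mem a) : x.mem b := by
  rw [← inf_eq_left.mpr h, x.mem_inf] at ha
  exact ha.2

/-- The ultrafilter theorem: a filter avoiding `a` extends to a point avoiding `a`. -/
theorem exists_of_filter (F : Set M) (top_mem : ⊤ ∈ F) (inf_mem : ∀ a ∈ F, ∀ b ∈ F, a ⊓ b ∈ F)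
    (mem_of_le : ∀ a b, a ≤ b → a ∈ F → b ∈ F) (a : M) (ha : a ∉ F) :
    ∃ x : StonePoint M, (∀ b ∈ F, x.mem b) ∧ ¬ x.mem a := by
  have hF : Order.IsPFilter F := Order.IsPFilter.of_def ⟨⊤, top_mem⟩
    (fun b hb c hc => ⟨b ⊓ c, inf_mem b hb c hc, inf_le_left, inf_le_right⟩)
    (fun {b c} hbc hb => mem_of_le b c hbc hb)
  obtain ⟨J, hJ, haJ, hFJ⟩ := DistribLattice.prime_ideal_of_disjoint_filter_ideal
    (F := hF.toPFilter) (I := Order.Ideal.principal a) (by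
      rw [Set.disjoint_left]
      intro b hb hba
      exact ha (mem_of_le b a hba hb))
  have hproper := hJ.toIsProper
  refine ⟨⟨fun b => b ∉ J, hproper.top_notMem, fun b c => ?_, fun b => ?_⟩, fun b hb => ?_, ?_⟩
  · rw [← not_or, not_iff_not]
    refine ⟨hJ.mem_or_mem, ?_⟩
    rintro (h | h)
    exacts [J.lower inf_le_left h, J.lower inf_le_right h]
  · rw [not_not]
    refine ⟨fun hbc => ?_, fun hb => ?_⟩
    · exact hJ.mem_or_compl_mem.resolve_right hbc
    · exact fun hbc => hproper.notMem_of_compl_mem hbc hb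
  · exact Set.disjoint_left.mp hFJ hb
  · exact not_not.mpr (haJ (Order.Ideal.mem_principal_self))

theorem le_iff_forall_mem (a b : M) : a ≤ b ↔ ∀ x : StonePoint M, x.mem a → x.mem b := by
  refine ⟨fun h x => x.mem_of_le h, fun h => ?_⟩
  by_contra hab
  obtain ⟨x, hx, hxb⟩ := exists_of_filter {c | a ≤ c} le_top (fun _ hc _ hd => le_inf hc hd)
    (fun _ _ hcd hc => le_trans hc hcd) b hab
  exact hxb (h x (hx a le_rfl))

theorem ext_mem {a b : M} (h : ∀ x : StonePoint M, x.mem a ↔ x.mem b) : a = b :=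
  le_antisymm ((le_iff_forall_mem a b).mpr fun x => (h x).mp)
    ((le_iff_forall_mem b a).mpr fun x => (h x).mpr)

theorem eq_top_iff_forall_mem (a : M) : a = ⊤ ↔ ∀ x : StonePoint M, x.mem a := by
  refine ⟨?_, fun h => ext_mem fun x => iff_of_true (h x) x.mem_top⟩
  rintro rfl x
  exact x.mem_top

/-! ### The dual frame and Löb's axiom. -/

/-- The accessibility relation of the dual frame of `(M, box)`. -/
def Rel (box : M → M) (x z : StonePoint M) : Prop := ∀ a, x.mem (box a) → z.mem a

variable {box : M → M}

/-- Normality makes the elements whose box lies in `x` a filter; if `a` is outside it, the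
ultrafilter theorem gives a successor of `x` omitting `a`. -/
theorem mem_box_iff (h : IsModalAlgebra box) (x : StonePoint M) (a : M) :
    x.mem (box a) ↔ ∀ z, Rel box x z → z.mem a := by
  refine ⟨fun hx z hz => hz a hx, fun hx => ?_⟩
  by_contra ha
  obtain ⟨z, hz, hza⟩ := exists_of_filter {b | x.mem (box b)}
    (by simpa [h.box_top] using x.mem_top)
    (fun b hb c hc => by
      rw [Set.mem_ofPred_eq, h.box_inf, x.mem_inf]
      exact ⟨hb, hc⟩)
    (fun b c hbc hb => by
      rw [Set.mem_ofPred_eq, ← inf_eq_left.mpr hbc, h.box_inf, x.mem_inf] at hb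
      exact hb.2) a ha
  exact hza (hx z hz)

theorem Rel.trans (h : IsK4Algebra box) {x y z : StonePoint M} (hxy : Rel box x y)
    (hyz : Rel box y z) : Rel box x z :=
  fun a ha => hyz a (hxy (box a) (x.mem_of_le (h.box_le_box_box a) ha))

/-- In a Magari algebra every clopen set that is seen from `x` has a maximal point seen from `x`. -/
theorem Rel.exists_maximal (h : IsMagariAlgebra box) {x z : StonePoint M} {a : M}
    (hxz : Rel box x z) (hz : z.mem a) :
    ∃ u, Rel box x u ∧ u.mem a ∧ ∀ w, Rel box u w → ¬ w.mem a := by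
  have hm := h.toIsModalAlgebra
  by_contra! hcon
  have hx : x.mem (box aᶜ) := by
    -- Without a maximal point, every successor of `x` in `a` sees another point of `a`, so □`aᶜ` →
    -- `aᶜ` holds at all successors of `x`.
    refine x.mem_of_le (h.loeb aᶜ) ?_
    rw [mem_box_iff hm]
    intro u hu
    rw [u.mem_himp, mem_box_iff hm, u.mem_compl]
    intro hbox hua
    obtain ⟨w, huw, hw⟩ := hcon u hu hua
    exact (w.mem_compl a).mp (hbox w huw) hw
  exact (z.mem_compl a).mp (hxz _ hx) hz

/-! ### Clopen predicates. -/

/-- The predicate `P` on points defines a clopen set. -/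
def IsClopenPred (P : StonePoint M → Prop) : Prop := ∃ a : M, ∀ x : StonePoint M, x.mem a ↔ P x

theorem IsClopenPred.not {P : StonePoint M → Prop} (h : IsClopenPred P) :
    IsClopenPred fun x => ¬ P x := by
  obtain ⟨a, ha⟩ := h
  exact ⟨aᶜ, fun x => by rw [x.mem_compl, ha]⟩

theorem IsClopenPred.and {P Q : StonePoint M → Prop} (hP : IsClopenPred P) (hQ : IsClopenPred Q) :
    IsClopenPred fun x => P x ∧ Q x := by
  obtain ⟨a, ha⟩ := hP
  obtain ⟨b, hb⟩ := hQ
  exact ⟨a ⊓ b, fun x => by rw [x.mem_inf, ha, hb]⟩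

theorem IsClopenPred.const (p : Prop) : IsClopenPred fun _ : StonePoint M => p := by
  by_cases hp : p
  · exact ⟨⊤, fun x => iff_of_true x.mem_top hp⟩
  · exact ⟨⊥, fun x => iff_of_false x.not_mem_bot hp⟩

theorem IsClopenPred.or {P Q : StonePoint M → Prop} (hP : IsClopenPred P) (hQ : IsClopenPred Q) :
    IsClopenPred fun x => P x ∨ Q x := by
  obtain ⟨a, ha⟩ := hP
  obtain ⟨b, hb⟩ := hQ
  exact ⟨a ⊔ b, fun x => by rw [x.mem_sup, ha, hb]⟩

theorem IsClopenPred.iff_const {P : StonePoint M → Prop} (h : IsClopenPred P) (p : Prop) :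
    IsClopenPred fun x => P x ↔ p := by
  by_cases hp : p
  · simpa [hp] using h
  · simpa [hp] using h.not

theorem IsClopenPred.forall {κ : Type*} [Finite κ] {P : κ → StonePoint M → Prop}
    (h : ∀ k, IsClopenPred (P k)) : IsClopenPred fun x => ∀ k, P k x := by
  have key : ∀ s : Set κ, s.Finite → IsClopenPred fun x => ∀ k ∈ s, P k x := by
    intro s hs
    induction s, hs using Set.Finite.induction_on with
    | empty => simpa using IsClopenPred.const (M := M) True
    | insert _ _ ih => simpa [Set.forall_mem_insert] using (h _).and ih
  simpa using key Set.univ Set.finite_univ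

theorem IsClopenPred.exists_rel (h : IsModalAlgebra box) {P : StonePoint M → Prop}
    (hP : IsClopenPred P) : IsClopenPred fun x => ∃ z, Rel box x z ∧ P z := by
  obtain ⟨a, ha⟩ := hP.not
  refine ⟨(box a)ᶜ, fun x => ?_⟩
  rw [x.mem_compl, mem_box_iff h]
  simp [ha]

/-- If all fibres of a map into a finite set are clopen, then so are all preimages. -/
theorem IsClopenPred.preimage {Y : Type*} [Finite Y] {f : StonePoint M → Y}
    (hf : ∀ y, IsClopenPred fun x => f x = y) (P : Y → Prop) : IsClopenPred fun x => P (f x) := by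
  have := IsClopenPred.forall fun y => ((hf y).not.or (IsClopenPred.const (P y)))
  convert this using 2 with x
  constructor
  · rintro h y
    by_cases hy : f x = y
    · exact Or.inr (hy ▸ h)
    · exact Or.inl hy
  · intro h
    exact (h (f x)).resolve_left (not_not.mpr rfl)

theorem IsClopenPred.eq_set {κ : Type*} [Finite κ] {f : StonePoint M → Set κ}
    (hf : ∀ k, IsClopenPred fun x => k ∈ f x) (s : Set κ) : IsClopenPred fun x => f x = s := by
  simpa only [Set.ext_iff] using IsClopenPred.forall fun k => (hf k).iff_const (k ∈ s)

/-! ### Profiles, the finite algebra and recolouring. -/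

section Profile

variable {ι : Type*}

/-- The colours of the points seen from `x`. -/
def seen (box : M → M) (τ : StonePoint M → ι) (x : StonePoint M) : Set ι :=
  {t | ∃ z, Rel box x z ∧ τ z = t}

/-- The colours seen from `x`, together with the colour of `x`. -/
def seenPlus (box : M → M) (τ : StonePoint M → ι) (x : StonePoint M) : Set ι :=
  insert (τ x) (seen box τ x)

/-- The profile of a point with respect to a colouring of all points. -/
def profile (box : M → M) (τ : StonePoint M → ι) (x : StonePoint M) : Set ι × Set ι :=
  (seen box τ x, seenPlus box τ x)

/-- The strict order induced on points by their profiles. -/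
def Below (box : M → M) (τ : StonePoint M → ι) (x z : StonePoint M) : Prop :=
  seenPlus box τ z ⊆ seen box τ x ∧ profile box τ x ≠ profile box τ z

variable {τ : StonePoint M → ι}

theorem seen_eq_of_profile_eq {x z : StonePoint M} (h : profile box τ x = profile box τ z) :
    seen box τ x = seen box τ z := congrArg Prod.fst h

theorem seenPlus_eq_of_profile_eq {x z : StonePoint M} (h : profile box τ x = profile box τ z) :
    seenPlus box τ x = seenPlus box τ z := congrArg Prod.snd h

theorem seen_subset_seenPlus (x : StonePoint M) : seen box τ x ⊆ seenPlus box τ x :=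
  Set.subset_insert _ _

theorem Rel.seenPlus_subset (h : IsK4Algebra box) {x z : StonePoint M} (hxz : Rel box x z) :
    seenPlus box τ z ⊆ seen box τ x := by
  rintro t (rfl | ⟨w, hw, rfl⟩)
  exacts [⟨z, hxz, rfl⟩, ⟨w, hxz.trans h hw, rfl⟩]

/-- An unseen colour of `u` is the only member of `seenPlus` outside `seen`, so it can be recovered
from the profile. -/
theorem color_eq_of_profile_eq {u x : StonePoint M} (hu : τ u ∉ seen box τ u)
    (h : profile box τ x = profile box τ u) : τ x = τ u := by
  have hmem : τ u ∈ seenPlus box τ x := by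
    rw [seenPlus_eq_of_profile_eq h]
    exact Set.mem_insert _ _
  rcases hmem with h' | h'
  · exact h'.symm
  · rw [seen_eq_of_profile_eq h] at h'
    exact absurd h' hu

theorem Below.profile_lt {x z : StonePoint M} (h : Below box τ x z) :
    profile box τ z < profile box τ x :=
  lt_of_le_of_ne ⟨(seen_subset_seenPlus z).trans h.1, h.1.trans (seen_subset_seenPlus x)⟩ h.2.symm

theorem Below.trans {x y z : StonePoint M} (hxy : Below box τ x y) (hyz : Below box τ y z) :
    Below box τ x z :=
  ⟨hyz.1.trans ((seen_subset_seenPlus y).trans hxy.1),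
    -- Distinctness of profiles is not transitive by itself; it comes from the strict decrease of
    -- profiles.
    (hyz.profile_lt.trans hxy.profile_lt).ne'⟩

theorem Rel.below_or_profile_eq (h : IsK4Algebra box) {x z : StonePoint M} (hxz : Rel box x z) :
    Below box τ x z ∨ profile box τ x = profile box τ z := by
  by_cases hp : profile box τ x = profile box τ z
  · exact Or.inr hp
  · exact Or.inl ⟨hxz.seenPlus_subset h, hp⟩

theorem isClopenPred_profile (h : IsModalAlgebra box) [Finite ι]
    (hτ : ∀ t, IsClopenPred fun x => τ x = t) (P : Set ι × Set ι → Prop) :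
    IsClopenPred fun x => P (profile box τ x) := by
  refine IsClopenPred.preimage (fun y => ?_) P
  have hseen : ∀ t, IsClopenPred fun x => t ∈ seen box τ x := fun t => (hτ t).exists_rel h
  have hplus : ∀ t, IsClopenPred fun x => t ∈ seenPlus box τ x := fun t => by
    simpa only [seenPlus, Set.mem_insert_iff, eq_comm] using (hτ t).or (hseen t)
  simpa only [profile, Prod.ext_iff] using
    (IsClopenPred.eq_set hseen y.1).and (IsClopenPred.eq_set hplus y.2)

/-- The elements of `M` that do not separate points with the same profile. -/
def profileAlgebra (box : M → M) (τ : StonePoint M → ι) : BooleanSubalgebra M where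
  carrier := {a | ∀ x z, profile box τ x = profile box τ z → (x.mem a ↔ z.mem a)}
  supClosed' a ha b hb x z h := by rw [x.mem_sup, z.mem_sup, ha x z h, hb x z h]
  infClosed' a ha b hb x z h := by rw [x.mem_inf, z.mem_inf, ha x z h, hb x z h]
  compl_mem' {a} ha x z h := by rw [x.mem_compl, z.mem_compl, ha x z h]
  bot_mem' x z _ := iff_of_false x.not_mem_bot z.not_mem_bot

theorem finite_profileAlgebra (box : M → M) (τ : StonePoint M → ι) [Finite ι] :
    Finite (profileAlgebra box τ) := by
  refine Finite.of_injective
    (fun a : profileAlgebra box τ => {y | ∃ x : StonePoint M, profile box τ x = y ∧ x.mem a})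
    fun a b hab => Subtype.ext (ext_mem fun x => ?_)
  have key : ∀ c : profileAlgebra box τ,
      profile box τ x ∈ {y | ∃ x : StonePoint M, profile box τ x = y ∧ x.mem c} ↔ x.mem c :=
    fun c => ⟨fun ⟨z, hz, hzc⟩ => (c.2 z x hz).mp hzc, fun hx => ⟨x, rfl, hx⟩⟩
  rw [← key a, ← key b]
  exact Set.ext_iff.mp hab _

/-- The box of the profile algebra determined by `Below`. -/
theorem exists_profileAlgebra_box (h : IsModalAlgebra box) [Finite ι]
    (hτ : ∀ t, IsClopenPred fun x => τ x = t) :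
    ∃ boxN : profileAlgebra box τ → profileAlgebra box τ, ∀ (a : profileAlgebra box τ)
      (x : StonePoint M), x.mem (boxN a) ↔ ∀ z, Below box τ x z → z.mem a := by
  have key : ∀ a : profileAlgebra box τ, ∃ b : profileAlgebra box τ,
      ∀ x : StonePoint M, x.mem b ↔ ∀ z, Below box τ x z → z.mem a := by
    intro a
    -- The condition on `x` is a property of its profile alone, so it is clopen and its element does
    -- not separate points of equal profile.
    obtain ⟨b, hb⟩ := isClopenPred_profile h hτ fun y =>
      ∀ z, seenPlus box τ z ⊆ y.1 ∧ y ≠ profile box τ z → z.mem a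
    exact ⟨⟨b, fun x z hxz => by simp only [hb, hxz]⟩, hb⟩
  exact ⟨fun a => (key a).choose, fun a => (key a).choose_spec⟩

theorem isMagariAlgebra_of_below [Finite ι] {boxN : profileAlgebra box τ → profileAlgebra box τ}
    (hN : ∀ a (x : StonePoint M), x.mem (boxN a) ↔ ∀ z, Below box τ x z → z.mem a) :
    IsMagariAlgebra boxN where
  box_top := Subtype.ext (ext_mem fun x => by
    rw [hN]
    exact iff_of_true (fun z _ => z.mem_top) x.mem_top)
  box_inf a b := Subtype.ext (ext_mem fun x => by
    simp only [BooleanSubalgebra.val_inf, mem_inf, hN]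
    exact ⟨fun h => ⟨fun z hz => (h z hz).1, fun z hz => (h z hz).2⟩,
      fun h z hz => ⟨h.1 z hz, h.2 z hz⟩⟩)
  box_le_box_box a := by
    refine (le_iff_forall_mem (boxN a : M) (boxN (boxN a) : M)).mpr fun x => ?_
    simp only [hN]
    exact fun h y hxy z hyz => h z (hxy.trans hyz)
  loeb a := by
    refine (le_iff_forall_mem (boxN (boxN a ⇨ a) : M) (boxN a : M)).mpr fun x => ?_
    simp only [hN, BooleanSubalgebra.val_himp, mem_himp]
    intro h z
    -- Profiles decrease strictly along `Below` and there are finitely many, so Löb's axiom is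
    -- well-founded induction.
    induction z using (InvImage.wf (profile box τ) (wellFounded_lt)).induction with
    | _ z ih => exact fun hxz => h z hxz fun w hzw => ih w hzw.profile_lt (hxz.trans hzw)

theorem isPreStableEmbedding_of_below (h : IsK4Algebra box)
    {boxN : profileAlgebra box τ → profileAlgebra box τ}
    (hN : ∀ a (x : StonePoint M), x.mem (boxN a) ↔ ∀ z, Below box τ x z → z.mem a) :
    IsPreStableEmbedding boxN box (profileAlgebra box τ).subtype where
  injective := BooleanSubalgebra.subtype_injective _
  boxPlus_le a := by
    refine (le_iff_forall_mem _ _).mpr fun x hx => ?_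
    have hx' : x.mem ((boxN a : M) ⊓ a) := hx
    change x.mem (box (a : M) ⊓ a)
    rw [mem_inf, hN] at hx'
    rw [mem_inf, mem_box_iff h.toIsModalAlgebra]
    refine ⟨fun z hxz => ?_, hx'.2⟩
    rcases hxz.below_or_profile_eq (τ := τ) h with hb | hp
    · exact hx'.1 z hb
    · exact (a.2 x z hp).mp hx'.2

/-- Below a point one finds exactly the colours that the point sees. -/
theorem exists_below_iff (h : IsMagariAlgebra box) (hτ : ∀ t, IsClopenPred fun x => τ x = t)
    {r : StonePoint M → StonePoint M} (hr : ∀ x, profile box τ (r x) = profile box τ x)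
    (x : StonePoint M) (t : ι) :
    (∃ z, Below box τ x z ∧ τ (r z) = t) ↔ t ∈ seen box τ x := by
  constructor
  · rintro ⟨z, hz, rfl⟩
    apply hz.1
    rw [← seenPlus_eq_of_profile_eq (hr z)]
    exact Set.mem_insert _ _
  · rintro ⟨z, hxz, hz⟩
    obtain ⟨a, ha⟩ := hτ t
    obtain ⟨u, hxu, hu, hmax⟩ := hxz.exists_maximal h ((ha z).mpr hz)
    rw [ha] at hu
    have hun : t ∉ seen box τ u := fun ⟨w, hw, hwt⟩ => hmax w hw ((ha w).mpr hwt)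
    -- The original `z` might share the profile of `x`; the maximal `u` cannot, since `x` sees `t`
    -- and `u` does not.
    refine ⟨u, ⟨hxu.seenPlus_subset h.toIsK4Algebra, fun hp => hun ?_⟩, ?_⟩
    · rw [← seen_eq_of_profile_eq hp]
      exact ⟨z, hxz, hz⟩
    · rw [color_eq_of_profile_eq (hu ▸ hun) (hr u), hu]

/-- Recolouring along a choice of profile representatives does not change the colours seen. -/
theorem exists_rel_iff (h : IsMagariAlgebra box) (hτ : ∀ t, IsClopenPred fun x => τ x = t)
    {r : StonePoint M → StonePoint M} (hr : ∀ x, profile box τ (r x) = profile box τ x)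
    (x : StonePoint M) (t : ι) :
    (∃ z, Rel box x z ∧ τ (r z) = t) ↔ t ∈ seen box τ x := by
  constructor
  · rintro ⟨z, hz, rfl⟩
    -- The new colour of `z` lies in the `seenPlus` common to its profile, all of which `x` already
    -- sees.
    apply hz.seenPlus_subset h.toIsK4Algebra
    rw [← seenPlus_eq_of_profile_eq (hr z)]
    exact Set.mem_insert _ _
  · rintro ⟨z, hxz, hz⟩
    obtain ⟨a, ha⟩ := hτ t
    obtain ⟨u, hxu, hu, hmax⟩ := hxz.exists_maximal h ((ha z).mpr hz)
    rw [ha] at hu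
    have hun : t ∉ seen box τ u := fun ⟨w, hw, hwt⟩ => hmax w hw ((ha w).mpr hwt)
    exact ⟨u, hxu, by rw [color_eq_of_profile_eq (hu ▸ hun) (hr u), hu]⟩

/-- Every colour is the colour of the representative of some point. -/
theorem exists_color_eq (h : IsMagariAlgebra box) (hτ : ∀ t, IsClopenPred fun x => τ x = t)
    {r : StonePoint M → StonePoint M} (hr : ∀ x, profile box τ (r x) = profile box τ x)
    (x : StonePoint M) : ∃ z, τ (r z) = τ x := by
  by_cases hx : τ x ∈ seen box τ x
  · obtain ⟨z, -, hz⟩ := (exists_rel_iff h hτ hr x _).mpr hx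
    exact ⟨z, hz⟩
  · exact ⟨x, color_eq_of_profile_eq hx (hr x)⟩

/-- One can choose a representative of every profile. -/
theorem exists_representatives (box : M → M) (τ : StonePoint M → ι) :
    ∃ r : StonePoint M → StonePoint M, (∀ x, profile box τ (r x) = profile box τ x) ∧
      ∀ x z, profile box τ x = profile box τ z → r x = r z := by
  have hs : ∀ y : Set.range (profile box τ), ∃ x, profile box τ x = y := fun y => y.2
  choose g hg using hs
  exact ⟨fun x => g ⟨profile box τ x, x, rfl⟩, fun x => hg _,
    fun x z hxz => congrArg g (Subtype.ext hxz)⟩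

end Profile

end StonePoint

/-! ### Formulae and subformulae. -/

/-- The extension of an assignment of the variables to all formulae. -/
def ModalFormula.eval {M : Type*} [BooleanAlgebra M] (box : M → M) (v : ℕ → M) : ModalFormula → M
  | .var p => v p
  | .bot => ⊥
  | .top => ⊤
  | .and φ ψ => φ.eval box v ⊓ ψ.eval box v
  | .neg φ => (φ.eval box v)ᶜ
  | .box φ => box (φ.eval box v)

theorem ModalFormula.isValuation_eval {M : Type*} [BooleanAlgebra M] (box : M → M) (v : ℕ → M) :
    IsValuation box (ModalFormula.eval box v) :=
  ⟨rfl, rfl, fun _ _ => rfl, fun _ => rfl, fun _ => rfl⟩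

theorem ModalFormula.self_mem_subformulas (φ : ModalFormula) : φ ∈ φ.subformulas := by
  cases φ <;> simp [ModalFormula.subformulas]

theorem ModalFormula.finite_subformulas (φ : ModalFormula) : φ.subformulas.Finite := by
  induction φ with
  | and φ ψ ihφ ihψ => exact (ihφ.union ihψ).insert _
  | neg φ ih => exact ih.insert _
  | box φ ih => exact ih.insert _
  | _ => exact Set.finite_singleton _

theorem ModalFormula.subformulas_subset {φ ψ : ModalFormula} (h : ψ ∈ φ.subformulas) :
    ψ.subformulas ⊆ φ.subformulas := by
  induction φ with
  | and φ χ ihφ ihχ =>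
    rcases h with rfl | h | h
    · rfl
    · exact (ihφ h).trans (Set.subset_union_left.trans (Set.subset_insert _ _))
    · exact (ihχ h).trans (Set.subset_union_right.trans (Set.subset_insert _ _))
  | neg φ ih | box φ ih =>
    rcases h with rfl | h
    · rfl
    · exact (ih h).trans (Set.subset_insert _ _)
  | _ => obtain rfl := h; rfl

theorem ModalRule.finite_sfor (r : ModalRule) : r.sfor.Finite := by
  have : r.sfor = ⋃ φ ∈ {φ | φ ∈ r.premises ∨ φ ∈ r.conclusions}, φ.subformulas := by
    ext ψ
    simp [ModalRule.sfor]
  rw [this]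
  exact (r.premises.finite_toSet.union r.conclusions.finite_toSet).biUnion
    fun φ _ => φ.finite_subformulas

theorem ModalRule.subformulaClosed_sfor (r : ModalRule) : SubformulaClosed r.sfor := by
  rintro φ ⟨χ, hχ, hφ⟩ ψ hψ
  exact ⟨χ, hχ, ModalFormula.subformulas_subset hφ hψ⟩

/-! ### Types as colours, and the truth lemma. -/

namespace StonePoint

variable {M : Type*} [BooleanAlgebra M] {box : M → M} {Θ : Set ModalFormula}
  {U V : ModalFormula → M}

/-- The set of members of `Θ` that are true at the point `x`. -/
def formulaType (Θ : Set ModalFormula) (V : ModalFormula → M) (x : StonePoint M) : Set Θ :=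
  {φ | x.mem (V φ)}

theorem mem_iff_of_formulaType_eq {x z : StonePoint M}
    (h : formulaType Θ V x = formulaType Θ V z) {φ : ModalFormula} (hφ : φ ∈ Θ) :
    x.mem (V φ) ↔ z.mem (V φ) :=
  Set.ext_iff.mp h ⟨φ, hφ⟩

theorem isClopenPred_formulaType (hΘ : Θ.Finite) (V : ModalFormula → M) (t : Set Θ) :
    IsClopenPred fun x => formulaType Θ V x = t := by
  have := hΘ.to_subtype
  exact IsClopenPred.eq_set (f := formulaType Θ V) (fun φ => ⟨V φ, fun _ => Iff.rfl⟩) t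

/-- If a relation `S` from `x` sees, after recolouring by `r`, exactly the types that `x` sees,
then `V (□ φ)` at `x` is computed by `S`. -/
theorem mem_map_box_iff (h : IsModalAlgebra box) (hV : IsValuation box V)
    {r : StonePoint M → StonePoint M} {S : StonePoint M → Prop} {x : StonePoint M}
    (hS : ∀ t, (∃ z, S z ∧ formulaType Θ V (r z) = t) ↔ t ∈ seen box (formulaType Θ V) x)
    {φ : ModalFormula} (hφ : φ ∈ Θ) :
    x.mem (V (.box φ)) ↔ ∀ z, S z → (r z).mem (V φ) := by
  rw [hV.map_box, mem_box_iff h]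
  constructor
  · intro hx z hz
    obtain ⟨w, hw, hwz⟩ := (hS _).mp ⟨z, hz, rfl⟩
    exact (mem_iff_of_formulaType_eq hwz hφ).mp (hx w hw)
  · intro hx w hw
    obtain ⟨z, hz, hzw⟩ := (hS _).mpr ⟨w, hw, rfl⟩
    exact (mem_iff_of_formulaType_eq hzw hφ).mp (hx z hz)

/-- Truth lemma: a valuation that reads off the variables at representatives does so on all of `Θ`. -/
theorem truth_iff (h : IsMagariAlgebra box) (hΘ : Θ.Finite) (hΘs : SubformulaClosed Θ)
    (hU : IsValuation box U) (hV : IsValuation box V) {r : StonePoint M → StonePoint M}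
    (hr : ∀ x, profile box (formulaType Θ V) (r x) = profile box (formulaType Θ V) x)
    (hvar : ∀ p x, x.mem (U (.var p)) ↔ (r x).mem (V (.var p))) (φ : ModalFormula) (hφ : φ ∈ Θ)
    (x : StonePoint M) : x.mem (U φ) ↔ (r x).mem (V φ) := by
  induction φ generalizing x with
  | var p => exact hvar p x
  | bot =>
    rw [hU.map_bot, hV.map_bot]
    exact iff_of_false x.not_mem_bot (r x).not_mem_bot
  | top =>
    rw [hU.map_top, hV.map_top]
    exact iff_of_true x.mem_top (r x).mem_top
  | and φ ψ ihφ ihψ =>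
    rw [hU.map_and, hV.map_and, x.mem_inf, (r x).mem_inf,
      ihφ (hΘs _ hφ (Or.inr (Or.inl φ.self_mem_subformulas))),
      ihψ (hΘs _ hφ (Or.inr (Or.inr ψ.self_mem_subformulas)))]
  | neg φ ih =>
    rw [hU.map_neg, hV.map_neg, x.mem_compl, (r x).mem_compl,
      ih (hΘs _ hφ (Or.inr φ.self_mem_subformulas))]
  | box φ ih =>
    have hφ' := hΘs _ hφ (Or.inr φ.self_mem_subformulas)
    rw [hU.map_box, mem_box_iff h.toIsModalAlgebra,
      mem_map_box_iff h.toIsModalAlgebra hV (r := r) (S := Rel box x) (fun t => by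
        rw [exists_rel_iff h (isClopenPred_formulaType hΘ V) hr,
          seen_eq_of_profile_eq (hr x)]) hφ']
    simp only [ih hφ']

end StonePoint

/-! ### Assembling the pre-filtration. -/

open StonePoint in
theorem mainTheorem10 {M : Type*} [BooleanAlgebra M] (box : M → M) (hM : IsMagariAlgebra box)
    (r : ModalRule) (hr : ¬ r.ValidOn box) :
    ∃ V : ModalFormula → M, IsValuation box V ∧ ¬ r.SatisfiedBy V ∧
      ∃ (N : BooleanSubalgebra M) (boxN : N → N) (V' : ModalFormula → N),
        IsMagariAlgebra boxN ∧ IsPreFiltration box V r.sfor N boxN V' := by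
  obtain ⟨W, hW, hrW⟩ : ∃ W, IsValuation box W ∧ ¬ r.SatisfiedBy W := by
    simpa only [ModalRule.ValidOn, not_forall, exists_prop] using hr
  have hm := hM.toIsModalAlgebra
  have hfin := r.finite_sfor
  have := hfin.to_subtype
  let τ := formulaType r.sfor W
  have hτ : ∀ t, IsClopenPred fun x => τ x = t := isClopenPred_formulaType hfin W
  obtain ⟨ρ, hρ, hρc⟩ := exists_representatives box τ
  have hv : ∀ p, ∃ a : profileAlgebra box τ, ∀ x : StonePoint M,
      x.mem a ↔ (ρ x).mem (W (.var p)) := by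
    intro p
    obtain ⟨a, ha⟩ := isClopenPred_profile hm hτ fun y =>
      ∃ x, profile box τ x = y ∧ (ρ x).mem (W (.var p))
    have ha' : ∀ x : StonePoint M, x.mem a ↔ (ρ x).mem (W (.var p)) := fun x => by
      rw [ha]
      exact ⟨fun ⟨z, hz, hzW⟩ => hρc z x hz ▸ hzW, fun hx => ⟨x, rfl, hx⟩⟩
    exact ⟨⟨a, fun x z hxz => by rw [ha', ha', hρc x z hxz]⟩, ha'⟩
  choose v hv using hv
  let V := ModalFormula.eval box fun p => (v p : M)
  have hV : IsValuation box V := ModalFormula.isValuation_eval _ _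
  have htruth : ∀ φ ∈ r.sfor, ∀ x : StonePoint M, x.mem (V φ) ↔ (ρ x).mem (W φ) :=
    truth_iff hM hfin r.subformulaClosed_sfor hV hW hρ hv
  obtain ⟨boxN, hN⟩ := exists_profileAlgebra_box hm hτ
  have hMagari := isMagariAlgebra_of_below hN
  have hfinN := finite_profileAlgebra box τ
  refine ⟨V, hV, ?_, profileAlgebra box τ, boxN, ModalFormula.eval boxN v, hMagari,
    hM.toIsK4Algebra, hV, hfin, r.subformulaClosed_sfor, hfinN, hMagari.toIsK4Algebra,
    ModalFormula.isValuation_eval _ _, ⟨profileAlgebra box τ, Set.toFinite _, ?_, ?_⟩,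
    fun _ _ => rfl, isPreStableEmbedding_of_below hM.toIsK4Algebra hN, ?_⟩
  · simp only [ModalRule.SatisfiedBy, Classical.not_imp, not_exists, not_and] at hrW ⊢
    refine ⟨fun γ hγ => (eq_top_iff_forall_mem _).mpr fun x => ?_, fun δ hδ hδV => ?_⟩
    · rw [htruth γ ⟨γ, Or.inl hγ, γ.self_mem_subformulas⟩, hrW.1 γ hγ]
      exact (ρ x).mem_top
    · have hδs : δ ∈ r.sfor := ⟨δ, Or.inr hδ, δ.self_mem_subformulas⟩
      refine hrW.2 δ hδ ((eq_top_iff_forall_mem _).mpr fun x => ?_)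
      -- Recolouring loses no colour, so a conclusion failing under `W` somewhere still fails under
      -- `V`.
      obtain ⟨z, hz⟩ := exists_color_eq hM hτ hρ x
      rw [← mem_iff_of_formulaType_eq hz hδs, ← htruth δ hδs, hδV]
      exact z.mem_top
  · rintro _ ⟨φ, hφ, rfl⟩ x z hxz
    rw [htruth φ hφ, htruth φ hφ, hρc x z hxz]
  · exact le_antisymm BooleanSubalgebra.subset_closure (BooleanSubalgebra.closure_le.mpr le_rfl)
  · rintro a ⟨φ, hφ, ha⟩
    have hφ' : φ ∈ r.sfor := r.subformulaClosed_sfor _ hφ (Or.inr φ.self_mem_subformulas)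
    refine ext_mem fun x => ?_
    change x.mem (boxN a) ↔ x.mem (box (a : M))
    -- The value becomes that of `W` at `ρ x`, which sees the same colours as `x`; those are the
    -- recoloured types reached by `Below` from `x`.
    rw [ha, ← hV.map_box, htruth _ hφ,
      mem_map_box_iff hm hW (S := Below box τ x) (fun t => by
        rw [exists_below_iff hM hτ hρ, seen_eq_of_profile_eq (hρ x)]) hφ', hN, ha]
    simp only [htruth φ hφ']
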